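/- Let $C_n=\{-1,1\}^n$ carry the uniform probability measure and coordinatewise multiplication. Every $f:C_n\to\mathbb R$ has a unique expansion $f=\sum_{S\subseteq\{1,\dots,n\}}a_S x^S$ with $x^S=\prod_{i\in S}x_i$. For $\gamma>0$ let $\Delta_\gamma f=-\sum_S|S|^\gamma a_Sx^S$, and let $e^{t\Delta_\gamma}$ be the semigroup generated by $\Delta_\gamma$, so that $e^{t\Delta_\gamma}f=\sum_S e^{-t|S|^\gamma}a_Sx^S$. **Theorem.** Let $0<\gamma<1$ and let $B$ be a finite set of positive integers (for instance $B=\{1,2\}$). There is a constant $c>0$, depending only on $\gamma$ and $B$ (hence only on $\gamma$ when $B=\{1,2\}$), such that for every $n$, every $t\ge0$ and every $f:C_n\to\mathbb R$ with $a_S=0$ whenever $|S|\notin B$: 1. for every $1\le p\le\infty$, $$\|e^{t\Delta_\gamma}f\|_p\le e^{-ct}\|f\|_p ;$$ 2. for every shift-invariant Banach space $X$ on $C_n$ (a linear space $X$ of functions $C_n\to\mathbb R$ with a norm $\|\cdot\|_X$ such that $f\in X$ implies $f(a\,\cdot)\in X$ and $\|f(a\,\cdot)\|_X=\|f\|_X$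 for all $a\in C_n$), if $f\in X$, then $e^{t\Delta_\gamma}f\in X$ and $$\|e^{t\Delta_\gamma}f\|_X\le e^{-ct}\|f\|_X .$$ -/

import Mathlib

open MeasureTheory ProbabilityTheory
open scoped ENNReal BigOperators

noncomputable section

namespace HammingCube

/-- The Hamming cube `{-1, 1}^n`, with its coordinatewise group structure (`ℤˣ = {1, -1}`). -/
abbrev Cube (n : ℕ) : Type := Fin n → ℤˣ

/-- The Walsh monomial `x^S = ∏_{i ∈ S} x_i`. -/
def walsh {n : ℕ} (S : Finset (Fin n)) : Cube n → ℝ :=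
  fun x => ∏ i ∈ S, ((x i : ℤ) : ℝ)

/-- The Fourier coefficient `a_S = 𝔼[f · x^S]`, linear in `f`. -/
def coeff {n : ℕ} (S : Finset (Fin n)) : (Cube n → ℝ) →ₗ[ℝ] ℝ where
  toFun f := (2 ^ n : ℝ)⁻¹ * ∑ x : Cube n, f x * walsh S x
  map_add' f g := by
    simp only [Pi.add_apply, add_mul, Finset.sum_add_distrib, mul_add]
  map_smul' r f := by
    simp only [Pi.smul_apply, smul_eq_mul, mul_assoc, ← Finset.mul_sum, RingHom.id_apply]
    ring

/-- The fractional Laplacian `Δ_γ = -(-Δ)^γ`: `Δ_γ f = -∑_S |S|^γ a_S x^S`. -/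
def fracLaplacian (n : ℕ) (γ : ℝ) : (Cube n → ℝ) →L[ℝ] (Cube n → ℝ) :=
  LinearMap.toContinuousLinearMap
    (-∑ S : Finset (Fin n), ((S.card : ℝ) ^ γ) • (coeff S).smulRight (walsh S))

/-- The semigroup `e^{tΔ_γ}`, as the exponential of the (bounded) operator `tΔ_γ`. -/
def heat (n : ℕ) (γ t : ℝ) : (Cube n → ℝ) →L[ℝ] (Cube n → ℝ) :=
  NormedSpace.exp (t • fracLaplacian n γ)

/-- `f` has all its Fourier modes in the levels of `B`: `a_S = 0` unless `|S| ∈ B`. -/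
def BandLocalized {n : ℕ} (B : Finset ℕ) (f : Cube n → ℝ) : Prop :=
  ∀ S : Finset (Fin n), S.card ∉ B → coeff S f = 0

/-- Every set of signs is measurable, so every function on the cube is. -/
instance : DiscreteMeasurableSpace ℤˣ :=
  ⟨fun s => ⟨Units.val '' s, MeasurableSet.of_discrete,
    Set.preimage_image_eq s Units.val_injective⟩⟩

/-- The uniform probability measure on the cube. -/
def cubeMeasure (n : ℕ) : Measure (Cube n) := uniformOn Set.univ

/-- The shift of `f` by the group element `a`. -/
def shift {n : ℕ} (a : Cube n) (f : Cube n → ℝ) : Cube n → ℝ := fun x => f (a * x)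

/-- A shift invariant Banach space of real functions on the cube: a shift invariant linear space of
functions with a shift invariant norm (completeness is automatic in finite dimension). -/
structure ShiftInvariantSpace (n : ℕ) where
  carrier : Submodule ℝ (Cube n → ℝ)
  norm : Seminorm ℝ carrier
  eq_zero_of_norm_eq_zero : ∀ f : carrier, norm f = 0 → f = 0
  shift_mem : ∀ (a : Cube n) (f : Cube n → ℝ), f ∈ carrier → shift a f ∈ carrier
  norm_shift : ∀ (a : Cube n) (f : carrier), norm ⟨shift a f, shift_mem a f f.2⟩ = norm f

end HammingCube

end

open MeasureTheory ProbabilityTheory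
open scoped ENNReal BigOperators Topology

namespace HammingCube

/-! On levels in `B` the heat multiplier may be replaced by any `h` that agrees with it there. If
the kernel of `h` is nonnegative, the flow is an average of translates with total mass `h 0`, which
bounds every shift-invariant norm (`heat_eq_sum_shift`). Take `h k = exp (-c t + t (g k - g 0))`
with `g` a positive multiplier, so that `h 0 = exp (-c t)`; exponentials preserve positivity. It
remains to find `c > 0` and `g` with `-k ^ γ = -c + g k - g 0` on `B`, independently of `n` and `t`.
Such `g` exists because `(-k ^ γ)` is interior to the cone of vectors `(g k - g 0)`. By duality this
is a strict inequality for functionals, tested on `g k = exp (-s k)`. It follows from `k ^ γ` being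
a positive multiple of `∫ (1 - exp (-s k)) s ^ (-1 - γ) ds` (`sum_mul_rpow_pos`). -/

/-! ### Walsh expansion and the spectral form of the semigroup. -/

lemma walsh_mul {n : ℕ} (S : Finset (Fin n)) (a x : Cube n) :
    walsh S (a * x) = walsh S a * walsh S x := by
  simp [walsh, Finset.prod_mul_distrib]

lemma walsh_empty {n : ℕ} (a : Cube n) : walsh ∅ a = 1 := by simp [walsh]

lemma sum_walsh_mul_walsh {n : ℕ} (S T : Finset (Fin n)) :
    ∑ x : Cube n, walsh S x * walsh T x = if S = T then (2 ^ n : ℝ) else 0 := by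
  have h1 : ∀ x : Cube n, walsh S x * walsh T x =
      ∏ i, ((if i ∈ S then ((x i : ℤ) : ℝ) else 1) * (if i ∈ T then ((x i : ℤ) : ℝ) else 1)) := by
    intro x
    rw [Finset.prod_mul_distrib]
    simp [walsh, Finset.prod_ite_mem]
  simp_rw [h1]
  have h2 := Finset.prod_univ_sum (fun _ : Fin n => (Finset.univ : Finset ℤˣ))
    (fun i u => (if i ∈ S then ((u : ℤ) : ℝ) else 1) * (if i ∈ T then ((u : ℤ) : ℝ) else 1))
  rw [Fintype.piFinset_univ] at h2
  rw [← h2]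
  have h3 : ∀ i : Fin n, ∑ u : ℤˣ,
      (if i ∈ S then ((u : ℤ) : ℝ) else 1) * (if i ∈ T then ((u : ℤ) : ℝ) else 1) =
      if (i ∈ S ↔ i ∈ T) then 2 else 0 := by
    intro i
    have hu : (Finset.univ : Finset ℤˣ) = {1, -1} := rfl
    rw [hu, Finset.sum_pair (by decide)]
    by_cases hS : i ∈ S <;> by_cases hT : i ∈ T <;> simp [hS, hT] <;> norm_num
  simp_rw [h3]
  split_ifs with h
  · simp [h]
  · obtain ⟨i, hi⟩ : ∃ i, ¬ (i ∈ S ↔ i ∈ T) := by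
      by_contra! hc
      exact h (Finset.ext hc)
    exact Finset.prod_eq_zero (Finset.mem_univ i) (by simp [hi])

lemma sum_pow_card_mul_walsh {n : ℕ} (ρ : ℝ) (a : Cube n) :
    ∑ S : Finset (Fin n), ρ ^ S.card * walsh S a = ∏ i, (1 + ρ * ((a i : ℤ) : ℝ)) := by
  rw [Finset.prod_one_add, Finset.powerset_univ]
  simp [walsh, Finset.prod_mul_distrib]

lemma coeff_walsh {n : ℕ} (S T : Finset (Fin n)) :
    coeff S (walsh T) = if T = S then 1 else 0 := by
  change (2 ^ n : ℝ)⁻¹ * ∑ x : Cube n, walsh T x * walsh S x = _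
  rw [sum_walsh_mul_walsh]
  split_ifs <;> simp

lemma sum_walsh_mul_walsh_swap {n : ℕ} (x y : Cube n) :
    ∑ S : Finset (Fin n), walsh S x * walsh S y = if x = y then (2 ^ n : ℝ) else 0 := by
  have h := sum_pow_card_mul_walsh 1 (x * y)
  simp only [one_pow, one_mul, walsh_mul] at h
  rw [h]
  have key : ∀ u v : ℤˣ, (1 : ℝ) + (((u * v : ℤˣ) : ℤ) : ℝ) = if u = v then 2 else 0 := by
    intro u v
    rcases Int.units_eq_one_or u with rfl | rfl <;> rcases Int.units_eq_one_or v with rfl | rfl <;>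
      norm_num
  simp_rw [Pi.mul_apply, key]
  split_ifs with h
  · simp [h]
  · obtain ⟨i, hi⟩ := Function.ne_iff.1 h
    exact Finset.prod_eq_zero (Finset.mem_univ i) (by simp [hi])

lemma eq_sum_coeff_smul_walsh {n : ℕ} (f : Cube n → ℝ) :
    f = ∑ S : Finset (Fin n), coeff S f • walsh S := by
  ext x
  simp only [Finset.sum_apply, Pi.smul_apply, smul_eq_mul]
  have : ∀ S : Finset (Fin n), coeff S f * walsh S x =
      (2 ^ n : ℝ)⁻¹ * ∑ y : Cube n, f y * (walsh S y * walsh S x) := by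
    intro S
    change (2 ^ n : ℝ)⁻¹ * (∑ y : Cube n, f y * walsh S y) * walsh S x = _
    rw [mul_assoc, Finset.sum_mul]
    simp_rw [mul_assoc]
  simp_rw [this]
  rw [← Finset.mul_sum, Finset.sum_comm]
  simp_rw [← Finset.mul_sum, sum_walsh_mul_walsh_swap]
  simp [mul_comm (f x)]

lemma fracLaplacian_walsh (n : ℕ) (γ : ℝ) (S : Finset (Fin n)) :
    fracLaplacian n γ (walsh S) = (-(S.card : ℝ) ^ γ) • walsh S := by
  change (-∑ T : Finset (Fin n), ((T.card : ℝ) ^ γ) • (coeff T).smulRight (walsh T))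
    (walsh S) = _
  simp [LinearMap.sum_apply, coeff_walsh]

lemma exp_apply_of_eigenvector {E : Type*} [NormedAddCommGroup E] [NormedSpace ℝ E]
    [CompleteSpace E] (L : E →L[ℝ] E) (r : ℝ) (v : E) (h : L v = r • v) :
    NormedSpace.exp L v = Real.exp r • v := by
  have hpow : ∀ k : ℕ, (L ^ k) v = r ^ k • v := by
    intro k
    induction k with
    | zero => simp
    | succ k ih => 
        rw [pow_succ', mul_apply_eq_comp, ih, map_smul, h, smul_smul, pow_succ]
  have h1 := (NormedSpace.exp_series_hasSum_exp' (𝕂 := ℝ) L).mapL (ContinuousLinearMap.apply ℝ E v)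
  have h2 := (NormedSpace.exp_series_hasSum_exp' (𝕂 := ℝ) r).smul_const v
  rw [← Real.exp_eq_exp_ℝ] at h2
  refine h1.unique ?_
  convert h2 using 2 with k
  simp [hpow, smul_smul]

lemma heat_apply (n : ℕ) (γ t : ℝ) (f : Cube n → ℝ) :
    heat n γ t f =
      ∑ S : Finset (Fin n), (coeff S f * Real.exp (-(t * (S.card : ℝ) ^ γ))) • walsh S := by
  conv_lhs => rw [eq_sum_coeff_smul_walsh f]
  rw [map_sum]
  refine Finset.sum_congr rfl fun S _ => ?_
  rw [map_smul, heat, exp_apply_of_eigenvector _ (-(t * (S.card : ℝ) ^ γ)), smul_smul]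
  rw [smul_apply, fracLaplacian_walsh, smul_smul, mul_neg]

/-! ### Multipliers with nonnegative kernel. -/

/-- The multiplier `x^S ↦ g |S| x^S` has a nonnegative convolution kernel on every cube. -/
def PositiveMultiplier (g : ℕ → ℝ) : Prop :=
  ∀ (n : ℕ) (a : Cube n), 0 ≤ ∑ S : Finset (Fin n), g S.card * walsh S a

namespace PositiveMultiplier

lemma pow_left {ρ : ℝ} (h0 : 0 ≤ ρ) (h1 : ρ ≤ 1) : PositiveMultiplier (fun k => ρ ^ k) := by
  intro n a
  rw [sum_pow_card_mul_walsh]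
  refine Finset.prod_nonneg fun i _ => ?_
  rcases Int.units_eq_one_or (a i) with h | h <;> rw [h] <;> push_cast <;> linarith

lemma add {g h : ℕ → ℝ} (hg : PositiveMultiplier g) (hh : PositiveMultiplier h) :
    PositiveMultiplier (fun k => g k + h k) := by
  intro n a
  simp_rw [add_mul, Finset.sum_add_distrib]
  exact add_nonneg (hg n a) (hh n a)

lemma const_mul {g : ℕ → ℝ} {r : ℝ} (hr : 0 ≤ r) (hg : PositiveMultiplier g) :
    PositiveMultiplier (fun k => r * g k) := by
  intro n a
  simp_rw [mul_assoc, ← Finset.mul_sum]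
  exact mul_nonneg hr (hg n a)

/-- The kernel of a product is the normalized convolution of the kernels; every element of the cube
is its own inverse, hence `b * a` below. -/
lemma mul {g h : ℕ → ℝ} (hg : PositiveMultiplier g) (hh : PositiveMultiplier h) :
    PositiveMultiplier (fun k => g k * h k) := by
  intro n a
  have key : (2 ^ n : ℝ)⁻¹ * ∑ b : Cube n, (∑ S : Finset (Fin n), g S.card * walsh S b) *
      (∑ T : Finset (Fin n), h T.card * walsh T (b * a)) =
      ∑ S : Finset (Fin n), g S.card * h S.card * walsh S a := by
    simp_rw [Finset.sum_mul_sum]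
    rw [Finset.sum_comm]
    have : ∀ S : Finset (Fin n), ∑ b : Cube n, ∑ T : Finset (Fin n),
        g S.card * walsh S b * (h T.card * walsh T (b * a)) =
        2 ^ n * (g S.card * h S.card * walsh S a) := by
      intro S
      rw [Finset.sum_comm]
      have : ∀ T : Finset (Fin n), ∑ b : Cube n,
          g S.card * walsh S b * (h T.card * walsh T (b * a)) =
          g S.card * h T.card * walsh T a * ∑ b : Cube n, walsh S b * walsh T b := by
        intro T
        rw [Finset.mul_sum]
        refine Finset.sum_congr rfl fun b _ => ?_
        rw [walsh_mul]
        ring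
      simp_rw [this, sum_walsh_mul_walsh]
      simp [mul_comm]
    simp_rw [this, ← Finset.mul_sum]
    rw [← mul_assoc, inv_mul_cancel₀ (by positivity), one_mul]
  rw [← key]
  exact mul_nonneg (by positivity)
    (Finset.sum_nonneg fun b _ => mul_nonneg (hg n b) (hh n _))

lemma pow {g : ℕ → ℝ} (hg : PositiveMultiplier g) (j : ℕ) :
    PositiveMultiplier (fun k => g k ^ j) := by
  induction j with
  | zero => simpa using pow_left (ρ := 1) zero_le_one le_rfl
  | succ j ih => simpa only [pow_succ] using ih.mul hg

lemma exp {g : ℕ → ℝ} (hg : PositiveMultiplier g) :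
    PositiveMultiplier (fun k => Real.exp (g k)) := by
  intro n a
  have h : HasSum (fun j : ℕ => ∑ S : Finset (Fin n), g S.card ^ j / j.factorial * walsh S a)
      (∑ S : Finset (Fin n), Real.exp (g S.card) * walsh S a) := by
    refine hasSum_sum fun S _ => HasSum.mul_right _ ?_
    rw [Real.exp_eq_exp_ℝ]
    exact NormedSpace.expSeries_div_hasSum_exp _
  refine h.nonneg fun j => ?_
  have := (hg.pow j).const_mul (r := (j.factorial : ℝ)⁻¹) (by positivity) n a
  simpa only [div_eq_inv_mul] using this

end PositiveMultiplier

/-- If the multiplier `h` is positive and agrees with the heat multiplier on the levels of `f`, then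
the heat flow averages translates of `f` against a positive kernel of mass `h 0`. -/
lemma heat_eq_sum_shift {n : ℕ} {γ t : ℝ} {B : Finset ℕ} {h : ℕ → ℝ}
    (hpos : PositiveMultiplier h) (hB : ∀ k ∈ B, h k = Real.exp (-(t * (k : ℝ) ^ γ)))
    {f : Cube n → ℝ} (hf : BandLocalized B f) :
    ∃ κ : Cube n → ℝ, (∀ a, 0 ≤ κ a) ∧ ∑ a, κ a = h 0 ∧
      heat n γ t f = ∑ a, κ a • shift a f := by
  have conv : ∀ T : Finset (Fin n), ∑ a : Cube n,
      ((2 ^ n : ℝ)⁻¹ * ∑ S : Finset (Fin n), h S.card * walsh S a) * walsh T a = h T.card := by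
    intro T
    simp_rw [mul_assoc, ← Finset.mul_sum, Finset.sum_mul]
    rw [Finset.sum_comm]
    simp_rw [mul_assoc, ← Finset.mul_sum, sum_walsh_mul_walsh]
    simp [mul_comm]
  refine ⟨fun a => (2 ^ n : ℝ)⁻¹ * ∑ S : Finset (Fin n), h S.card * walsh S a,
    fun a => mul_nonneg (by positivity) (hpos n a), ?_, ?_⟩
  · simpa [walsh_empty] using conv ∅
  · rw [heat_apply]
    ext x
    have hx : ∀ a : Cube n, shift a f x =
        ∑ T : Finset (Fin n), coeff T f * (walsh T a * walsh T x) := by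
      intro a
      conv_lhs => rw [shift, eq_sum_coeff_smul_walsh f]
      simp [walsh_mul]
    simp only [Finset.sum_apply, Pi.smul_apply, smul_eq_mul, hx]
    conv_rhs => enter [2, a]; rw [Finset.mul_sum]
    rw [Finset.sum_comm]
    refine Finset.sum_congr rfl fun T _ => ?_
    have h1 : coeff T f * Real.exp (-(t * (T.card : ℝ) ^ γ)) = coeff T f * h T.card := by
      by_cases hT : T.card ∈ B
      · rw [hB _ hT]
      · simp [hf T hT]
    rw [h1, ← conv T, Finset.mul_sum, Finset.sum_mul]
    refine Finset.sum_congr rfl fun a _ => ?_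
    ring

/-! ### Norm bounds for averages of translates. -/

lemma measurePreserving_shift {n : ℕ} (a : Cube n) :
    MeasurePreserving (fun x => a * x) (cubeMeasure n) (cubeMeasure n) := by
  refine ⟨measurable_of_finite _, ?_⟩
  ext s hs
  rw [Measure.map_apply (measurable_of_finite _) hs]
  simp only [cubeMeasure, uniformOn, cond_apply MeasurableSet.univ, Set.univ_inter]
  congr 1
  rw [← Measure.map_apply (measurable_of_finite _) hs, map_mul_left_eq_self]

lemma eLpNorm_sum_shift_le {n : ℕ} (κ : Cube n → ℝ) (hκ : ∀ a, 0 ≤ κ a) (f : Cube n → ℝ)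
    {p : ℝ≥0∞} (hp : 1 ≤ p) :
    eLpNorm (∑ a, κ a • shift a f) p (cubeMeasure n) ≤
      ENNReal.ofReal (∑ a, κ a) * eLpNorm f p (cubeMeasure n) := by
  have hm : ∀ g : Cube n → ℝ, AEStronglyMeasurable g (cubeMeasure n) := fun g =>
    (measurable_of_finite g).aestronglyMeasurable
  refine (eLpNorm_sum_le (fun a _ => hm _) hp).trans ?_
  rw [ENNReal.ofReal_sum_of_nonneg fun a _ => hκ a, Finset.sum_mul]
  refine Finset.sum_le_sum fun a _ => ?_
  rw [eLpNorm_const_smul, Real.enorm_of_nonneg (hκ a)]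
  gcongr
  exact (eLpNorm_comp_measurePreserving (hm f) (measurePreserving_shift a)).le

lemma ShiftInvariantSpace.norm_sum_shift_le {n : ℕ} (X : ShiftInvariantSpace n) (κ : Cube n → ℝ)
    (hκ : ∀ a, 0 ≤ κ a) (f : Cube n → ℝ) (hf : f ∈ X.carrier) :
    ∃ hg : ∑ a, κ a • shift a f ∈ X.carrier,
      X.norm ⟨∑ a, κ a • shift a f, hg⟩ ≤ (∑ a, κ a) * X.norm ⟨f, hf⟩ := by
  refine ⟨X.carrier.sum_mem fun a _ => X.carrier.smul_mem _ (X.shift_mem a f hf), ?_⟩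
  have h : (⟨∑ a, κ a • shift a f, X.carrier.sum_mem fun a _ =>
      X.carrier.smul_mem _ (X.shift_mem a f hf)⟩ : X.carrier) =
      ∑ a, κ a • (⟨shift a f, X.shift_mem a f hf⟩ : X.carrier) := by
    ext1
    simp
  rw [h, Finset.sum_mul]
  refine (Finset.le_sum_of_subadditive X.norm (map_zero X.norm).le (map_add_le_add X.norm) _ _).trans (Finset.sum_le_sum fun a _ => ?_)
  rw [map_smul_eq_mul, Real.norm_of_nonneg (hκ a), X.norm_shift a ⟨f, hf⟩]

/-! ### The integral representation of `k ^ γ`. -/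

open Set in
-- Near `0` the integrand is at most `s ^ (-γ)`, which needs `γ < 1`; at infinity it is at most `s ^
-- (-1 - γ)`, which needs `γ > 0`.
lemma integrableOn_one_sub_exp_neg_mul_rpow {γ : ℝ} (hγ0 : 0 < γ) (hγ1 : γ < 1) :
    IntegrableOn (fun s : ℝ => (1 - Real.exp (-s)) * s ^ (-1 - γ)) (Ioi 0) := by
  have hmeas : Measurable (fun s : ℝ => (1 - Real.exp (-s)) * s ^ (-1 - γ)) := by fun_prop
  rw [← Ioc_union_Ioi_eq_Ioi (zero_le_one (α := ℝ))]
  refine IntegrableOn.union ?_ ?_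
  · have h : IntegrableOn (fun s : ℝ => s ^ (-γ)) (Ioc 0 1) :=
      (intervalIntegrable_iff_integrableOn_Ioc_of_le zero_le_one).1
        (intervalIntegral.intervalIntegrable_rpow' (by linarith))
    refine Integrable.mono' h hmeas.aestronglyMeasurable ?_
    filter_upwards [ae_restrict_mem measurableSet_Ioc] with s hs
    have h1 : 0 ≤ 1 - Real.exp (-s) := by
      have := Real.exp_le_one_iff.2 (neg_nonpos.2 hs.1.le)
      linarith
    have h2 : 1 - Real.exp (-s) ≤ s := by linarith [Real.add_one_le_exp (-s)]
    have h3 : 0 ≤ s ^ (-1 - γ) := Real.rpow_nonneg hs.1.le _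
    rw [Real.norm_of_nonneg (mul_nonneg h1 h3)]
    calc _ ≤ s * s ^ (-1 - γ) := by gcongr
      _ = s ^ (-γ) := by
        rw [← Real.rpow_one_add' hs.1.le (by linarith)]
        congr 1
        ring
  · have h : IntegrableOn (fun s : ℝ => s ^ (-1 - γ)) (Ioi 1) :=
      integrableOn_Ioi_rpow_of_lt (by linarith) one_pos
    refine Integrable.mono' h hmeas.aestronglyMeasurable ?_
    filter_upwards [ae_restrict_mem measurableSet_Ioi] with s hs
    have hs0 : (0 : ℝ) < s := zero_lt_one.trans hs
    have h1 : 0 ≤ 1 - Real.exp (-s) := by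
      have := Real.exp_le_one_iff.2 (neg_nonpos.2 hs0.le)
      linarith
    have h3 : 0 ≤ s ^ (-1 - γ) := Real.rpow_nonneg hs0.le _
    rw [Real.norm_of_nonneg (mul_nonneg h1 h3)]
    exact mul_le_of_le_one_left h3 (by linarith [Real.exp_pos (-s)])

open Set in
lemma integral_one_sub_exp_neg_mul_rpow_pos {γ : ℝ} (hγ0 : 0 < γ) (hγ1 : γ < 1) :
    0 < ∫ s in Ioi (0 : ℝ), (1 - Real.exp (-s)) * s ^ (-1 - γ) := by
  have hpos : ∀ s ∈ Ioi (0 : ℝ), 0 < (1 - Real.exp (-s)) * s ^ (-1 - γ) := by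
    intro s hs
    have := Real.exp_lt_one_iff.2 (neg_lt_zero.2 hs)
    exact mul_pos (by linarith) (Real.rpow_pos_of_pos hs _)
  rw [setIntegral_pos_iff_support_of_nonneg_ae ?_
    (integrableOn_one_sub_exp_neg_mul_rpow hγ0 hγ1)]
  · rw [inter_eq_right.2 fun s hs => Function.mem_support.2 (hpos s hs).ne']
    simp
  · filter_upwards [ae_restrict_mem measurableSet_Ioi] with s hs using (hpos s hs).le

lemma one_sub_exp_pow_mul_rpow_eq {γ s : ℝ} (hs : 0 < s) {k : ℕ} (hk : 0 < k) :
    (1 - Real.exp (-s) ^ k) * s ^ (-1 - γ) =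
      (k : ℝ) ^ (1 + γ) * ((1 - Real.exp (-(k * s))) * (k * s) ^ (-1 - γ)) := by
  have hk' : (0 : ℝ) < k := Nat.cast_pos.2 hk
  rw [Real.mul_rpow hk'.le hs.le, ← Real.exp_nat_mul, mul_neg]
  have : (k : ℝ) ^ (1 + γ) * (k : ℝ) ^ (-1 - γ) = 1 := by
    rw [← Real.rpow_add hk']
    simp
  linear_combination (-(1 - Real.exp (-(k * s))) * s ^ (-1 - γ)) * this

open Set in
lemma integrableOn_one_sub_exp_pow_mul_rpow {γ : ℝ} (hγ0 : 0 < γ) (hγ1 : γ < 1) {k : ℕ}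
    (hk : 0 < k) :
    IntegrableOn (fun s : ℝ => (1 - Real.exp (-s) ^ k) * s ^ (-1 - γ)) (Ioi 0) := by
  have hk' : (0 : ℝ) < k := Nat.cast_pos.2 hk
  have h := (integrableOn_Ioi_comp_mul_left_iff
    (fun s : ℝ => (1 - Real.exp (-s)) * s ^ (-1 - γ)) 0 hk').2
    (by simpa using integrableOn_one_sub_exp_neg_mul_rpow hγ0 hγ1)
  exact IntegrableOn.congr_fun (h.const_mul ((k : ℝ) ^ (1 + γ)))
    (fun s hs => (one_sub_exp_pow_mul_rpow_eq hs hk).symm) measurableSet_Ioi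

open Set in
lemma integral_one_sub_exp_pow_mul_rpow {γ : ℝ} {k : ℕ} (hk : 0 < k) :
    ∫ s in Ioi (0 : ℝ), (1 - Real.exp (-s) ^ k) * s ^ (-1 - γ) =
      (k : ℝ) ^ γ * ∫ s in Ioi (0 : ℝ), (1 - Real.exp (-s)) * s ^ (-1 - γ) := by
  have hk' : (0 : ℝ) < k := Nat.cast_pos.2 hk
  rw [setIntegral_congr_fun measurableSet_Ioi
    fun s hs => one_sub_exp_pow_mul_rpow_eq (γ := γ) hs hk, integral_const_mul,
    integral_comp_mul_left_Ioi (fun s : ℝ => (1 - Real.exp (-s)) * s ^ (-1 - γ)) 0 hk',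
    mul_zero, smul_eq_mul, ← mul_assoc, Real.rpow_add hk', Real.rpow_one]
  field_simp

lemma eq_zero_of_sum_mul_pow_eq {B : Finset ℕ} (hB : 0 ∉ B) (b : B → ℝ)
    (h : ∀ s : ℝ, 0 < s → ∑ k, b k * (1 - Real.exp (-s) ^ (k : ℕ)) = 0) : b = 0 := by
  classical
  let q : Polynomial ℝ := ∑ k, Polynomial.C (b k) * (1 - Polynomial.X ^ (k : ℕ))
  have hq : q = 0 := by
    refine Polynomial.eq_zero_of_infinite_isRoot _
      ((Set.Ioo_infinite (zero_lt_one (α := ℝ))).mono fun ρ hρ => ?_)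
    have := h (-Real.log ρ) (neg_pos.2 (Real.log_neg hρ.1 hρ.2))
    simpa [q, Polynomial.IsRoot, Polynomial.eval_finsetSum, Real.exp_log hρ.1] using this
  ext j
  -- Away from the constant term, the coefficient of `X ^ j` in `q` is `-b j`.
  have hj : (j : ℕ) ≠ 0 := fun h => hB (h ▸ j.2)
  have := congrArg (fun r => Polynomial.coeff r j) hq
  simpa [q, Polynomial.finsetSum_coeff, Polynomial.coeff_one, Polynomial.coeff_X_pow, hj,
    Subtype.ext_iff.symm, Finset.sum_ite_eq] using this

open Set in
-- The sum is a positive multiple of the integral of `Q s * s ^ (-1 - γ)`, and `Q` is continuous,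
-- nonnegative and, being a nonzero polynomial in `exp (-s)`, not identically zero.
lemma sum_mul_rpow_pos {γ : ℝ} (hγ0 : 0 < γ) (hγ1 : γ < 1) {B : Finset ℕ} (hB : 0 ∉ B)
    (b : B → ℝ) (hb : b ≠ 0)
    (h : ∀ s : ℝ, 0 < s → 0 ≤ ∑ k, b k * (1 - Real.exp (-s) ^ (k : ℕ))) :
    0 < ∑ k, b k * (k : ℝ) ^ γ := by
  have hk : ∀ k : B, 0 < (k : ℕ) := fun k => Nat.pos_of_ne_zero fun h => hB (h ▸ k.2)
  set Q : ℝ → ℝ := fun s => ∑ k, b k * (1 - Real.exp (-s) ^ (k : ℕ)) with hQ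
  have hint : ∀ k : B, IntegrableOn
      (fun s : ℝ => b k * ((1 - Real.exp (-s) ^ (k : ℕ)) * s ^ (-1 - γ))) (Ioi 0) := fun k =>
    (integrableOn_one_sub_exp_pow_mul_rpow hγ0 hγ1 (hk k)).const_mul _
  have hQs : (fun s => Q s * s ^ (-1 - γ)) =
      fun s => ∑ k, b k * ((1 - Real.exp (-s) ^ (k : ℕ)) * s ^ (-1 - γ)) := by
    ext s
    simp only [hQ, Finset.sum_mul, mul_assoc]
  have heq : ∫ s in Ioi (0 : ℝ), Q s * s ^ (-1 - γ) = (∑ k, b k * (k : ℝ) ^ γ) *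
      ∫ s in Ioi (0 : ℝ), (1 - Real.exp (-s)) * s ^ (-1 - γ) := by
    rw [hQs, integral_finsetSum _ fun k _ => hint k, Finset.sum_mul]
    refine Finset.sum_congr rfl fun k _ => ?_
    rw [integral_const_mul, integral_one_sub_exp_pow_mul_rpow (hk k), mul_assoc]
  have hcont : Continuous Q := by fun_prop
  have hpos : 0 < ∫ s in Ioi (0 : ℝ), Q s * s ^ (-1 - γ) := by
    rw [setIntegral_pos_iff_support_of_nonneg_ae]
    · obtain ⟨s₀, hs₀, hne⟩ : ∃ s : ℝ, 0 < s ∧ Q s ≠ 0 := by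
        by_contra! hc
        exact hb (eq_zero_of_sum_mul_pow_eq hB b hc)
      have hopen : IsOpen (Q ⁻¹' {0}ᶜ ∩ Ioi 0) :=
        (isOpen_compl_singleton.preimage hcont).inter isOpen_Ioi
      refine (hopen.measure_pos volume ⟨s₀, hne, hs₀⟩).trans_le (measure_mono fun s hs => ?_)
      exact ⟨mul_ne_zero hs.1 (Real.rpow_pos_of_pos hs.2 _).ne', hs.2⟩
    · filter_upwards [ae_restrict_mem measurableSet_Ioi] with s hs
      exact mul_nonneg (h s hs) (Real.rpow_nonneg (le_of_lt hs) _)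
    · rw [hQs]
      exact integrable_finsetSum _ fun k _ => hint k
  rw [heq] at hpos
  exact pos_of_mul_pos_left hpos (integral_one_sub_exp_neg_mul_rpow_pos hγ0 hγ1).le

/-! ### Duality and the cone of positive multipliers. -/

/-- A convex cone of a finite-dimensional space contains in its interior every point at which each
nonzero functional that is nonpositive on the cone is negative. -/
lemma mem_interior_of_forall_dual_neg {E : Type*} [NormedAddCommGroup E] [NormedSpace ℝ E]
    [FiniteDimensional ℝ E] (K : PointedCone ℝ E) (v : E)
    (h : ∀ φ : E →L[ℝ] ℝ, φ ≠ 0 → (∀ x ∈ K, φ x ≤ 0) → φ v < 0) :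
    v ∈ interior (K : Set E) := by
  have hconv : Convex ℝ (K : Set E) := K.toConvexCone.convex
  have hne : (interior (K : Set E)).Nonempty := by
    rw [hconv.interior_nonempty_iff_affineSpan_eq_top]
    by_contra hc
    have hlt : Submodule.span ℝ (K : Set E) < ⊤ := by
      refine lt_top_iff_ne_top.2 fun ht => hc (SetLike.coe_injective ?_)
      rw [← Set.insert_eq_of_mem (SetLike.mem_coe.2 K.zero_mem), affineSpan_insert_zero, ht]
      rfl
    -- A functional vanishing on the span contradicts `h`, since both it and its negative would be
    -- negative at `v`.
    obtain ⟨φ, hφ, hle⟩ := Submodule.exists_le_ker_of_lt_top _ hlt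
    have hz : ∀ x ∈ Submodule.span ℝ (K : Set E), φ x = 0 := fun x hx => hle hx
    have h1 := h φ.toContinuousLinearMap (by simpa using hφ)
      (fun x hx => (hz x (Submodule.subset_span hx)).le)
    have h2 := h (-φ.toContinuousLinearMap) (by simpa using hφ)
      (fun x hx => by simp [hz x (Submodule.subset_span hx)])
    simp only [neg_apply] at h2
    linarith
  by_contra hv
  obtain ⟨φ, hφ⟩ := geometric_hahn_banach_open_point hconv.interior isOpen_interior hv
  have hle : ∀ x ∈ K, φ x ≤ φ v := by
    intro x hx
    have hx' : x ∈ closure (interior (K : Set E)) := by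
      rw [hconv.closure_interior_eq_closure_of_nonempty_interior hne]
      exact subset_closure hx
    exact closure_minimal (fun y hy => (hφ y hy).le)
      (isClosed_le φ.continuous continuous_const) hx'
  have hφ0 : φ ≠ 0 := by
    rintro rfl
    obtain ⟨y, hy⟩ := hne
    simpa using hφ y hy
  have hneg : ∀ x ∈ K, φ x ≤ 0 := by
    intro x hx
    by_contra! hpos
    -- Rescaling `x` in the cone makes `φ` take the value `|φ v| + 1`, above its bound `φ v`.
    have hr : 0 ≤ (|φ v| + 1) / φ x := by positivity
    have := hle (((|φ v| + 1) / φ x) • x) (K.smul_mem hr hx)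
    rw [map_smul, smul_eq_mul, div_mul_cancel₀ _ hpos.ne'] at this
    linarith [le_abs_self (φ v)]
  have h0 := hle 0 K.zero_mem
  rw [map_zero] at h0
  exact absurd (h φ hφ0 hneg) (not_lt.2 h0)

/-- The vectors `(g k - g 0)_{k ∈ B}` obtained from positive multipliers `g`. -/
def multiplierCone (B : Finset ℕ) : PointedCone ℝ (B → ℝ) where
  carrier := {x | ∃ g : ℕ → ℝ, PositiveMultiplier g ∧ ∀ k : B, x k = g k - g 0}
  add_mem' := by
    rintro x y ⟨g, hg, hx⟩ ⟨h, hh, hy⟩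
    refine ⟨_, hg.add hh, fun k => ?_⟩
    rw [Pi.add_apply, hx, hy]
    ring
  zero_mem' := ⟨fun _ => 1, by simpa using PositiveMultiplier.pow_left zero_le_one le_rfl,
    fun k => by simp⟩
  smul_mem' := by
    rintro r x ⟨g, hg, hx⟩
    refine ⟨_, hg.const_mul r.2, fun k => ?_⟩
    rw [Pi.smul_apply, hx, ← mul_sub]
    rfl

lemma neg_rpow_mem_interior_multiplierCone {γ : ℝ} (hγ0 : 0 < γ) (hγ1 : γ < 1) {B : Finset ℕ}
    (hB : 0 ∉ B) :
    (fun k : B => -((k : ℕ) : ℝ) ^ γ) ∈ interior (multiplierCone B : Set (B → ℝ)) := by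
  classical
  refine mem_interior_of_forall_dual_neg _ _ fun φ hφ hle => ?_
  set b : B → ℝ := fun k => φ (Pi.single k 1) with hb
  have hφb : ∀ x : B → ℝ, φ x = ∑ k, b k * x k := by
    intro x
    conv_lhs => rw [pi_eq_sum_univ' x, map_sum]
    refine Finset.sum_congr rfl fun k _ => ?_
    rw [map_smul, smul_eq_mul, mul_comm]
  have hb0 : b ≠ 0 := by
    rintro h
    refine hφ (ContinuousLinearMap.ext fun x => ?_)
    simp [hφb, h]
  have := sum_mul_rpow_pos hγ0 hγ1 hB b hb0 fun s hs => ?_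
  · rw [hφb]
    simpa using this
  · have h := hle (fun k => Real.exp (-s) ^ (k : ℕ) - 1) ⟨fun k => Real.exp (-s) ^ k,
      PositiveMultiplier.pow_left (Real.exp_pos _).le (Real.exp_le_one_iff.2 (by linarith)),
      fun k => by simp⟩
    rw [hφb] at h
    simp only [mul_sub, Finset.sum_sub_distrib] at h ⊢
    linarith

/-- An interior point stays in the cone after a small move along the all-ones vector; the length of
that move is the decay rate `c`. -/
lemma exists_positiveMultiplier_sub_eq {γ : ℝ} (hγ0 : 0 < γ) (hγ1 : γ < 1) {B : Finset ℕ}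
    (hB : 0 ∉ B) :
    ∃ c : ℝ, 0 < c ∧ ∃ g : ℕ → ℝ, PositiveMultiplier g ∧
      ∀ k ∈ B, -(k : ℝ) ^ γ = -c + (g k - g 0) := by
  have hmem := mem_interior_iff_mem_nhds.1 (neg_rpow_mem_interior_multiplierCone hγ0 hγ1 hB)
  have hcont : Filter.Tendsto (fun c : ℝ => fun k : B => -((k : ℕ) : ℝ) ^ γ + c) (𝓝[>] 0)
      (𝓝 fun k : B => -((k : ℕ) : ℝ) ^ γ) := by
    refine Filter.Tendsto.mono_left ?_ nhdsWithin_le_nhds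
    refine Continuous.tendsto' (by fun_prop) _ _ (by simp)
  obtain ⟨c, ⟨g, hg, hgk⟩, hc⟩ :=
    ((hcont.eventually hmem).and self_mem_nhdsWithin).exists
  refine ⟨c, hc, g, hg, fun k hk => ?_⟩
  have := hgk ⟨k, hk⟩
  simp only at this
  linarith

end HammingCube

theorem theorem5p4 (γ : ℝ) (hγ0 : 0 < γ) (hγ1 : γ < 1) (B : Finset ℕ) (hB : 0 ∉ B) :
    ∃ c : ℝ, 0 < c ∧
      ∀ (n : ℕ) (f : HammingCube.Cube n → ℝ), HammingCube.BandLocalized B f →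
        ∀ t : ℝ, 0 ≤ t →
          (∀ p : ℝ≥0∞, 1 ≤ p →
            eLpNorm (HammingCube.heat n γ t f) p (HammingCube.cubeMeasure n) ≤
              ENNReal.ofReal (Real.exp (-c * t)) *
                eLpNorm f p (HammingCube.cubeMeasure n)) ∧
          (∀ (X : HammingCube.ShiftInvariantSpace n) (hf : f ∈ X.carrier),
            ∃ hg : HammingCube.heat n γ t f ∈ X.carrier,
              X.norm ⟨HammingCube.heat n γ t f, hg⟩ ≤
                Real.exp (-c * t) * X.norm ⟨f, hf⟩) := by
  obtain ⟨c, hc, g, hg, hgk⟩ := HammingCube.exists_positiveMultiplier_sub_eq hγ0 hγ1 hB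
  refine ⟨c, hc, fun n f hf t ht => ?_⟩
  -- The factor `exp (-c t - t g 0)` normalizes the value at level `0`, the kernel mass, to `exp (-c
  -- t)`.
  have hpos := ((hg.const_mul ht).exp).const_mul (Real.exp_pos (-c * t - t * g 0)).le
  obtain ⟨κ, hκ, hsum, heq⟩ := HammingCube.heat_eq_sum_shift (γ := γ) (t := t) hpos
    (fun k hk => by
      rw [← Real.exp_add]
      congr 1
      linear_combination (-t) * hgk k hk) hf
  have hmass : ∑ a, κ a = Real.exp (-c * t) := by
    rw [hsum, ← Real.exp_add, sub_add_cancel]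
  rw [heq, ← hmass]
  exact ⟨fun p hp => HammingCube.eLpNorm_sum_shift_le κ hκ f hp,
    fun X hX => X.norm_sum_shift_le κ hκ f hX⟩
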